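/- **Setting.** Let $n=2^q$ ($q\ge 0$), let $U=(U_h)_{h=0,\dots,n-1}$ be real $m\times m$ matrices such that the block-upper triangular block-Toeplitz matrix $\mathcal T(U)$ with first block-row $[U_0,\dots,U_{n-1}]$ is a subgenerator (nonnegative off-diagonal entries, negative diagonal entries, nonpositive row sums), and let $\mathcal C(U)$ be the block-circulant matrix with first block-row $[U_0,\dots,U_{n-1}]$, i.e. with block $U_{(j-i)\bmod n}$ in position $(i,j)$. Write $\|A\|_\infty=\max_i\sum_j|a_{ij}|$, $\omega_s=e^{2\pi \mathrm i/2^s}$ and $F=(\omega_q^{ij})_{i,j=0,\dots,n-1}$, $\mathcal F=F\otimes I_m$. *Algorithm (exponential of a block-circulant matrix).* (1) $V=\mathcal F^HU$; (2) $W_k=e^{V_k}$, $k=0,\dots,n-1$; (3) $Y=\frac1n\mathcal FW$. *Floating point arithmetic with precision $\mu$.* It is binary, without underflow or overflow, and follows the standard model: each real operation returns $\mathrm{fl}(\cdot)$ of its exact result, where $|\mathrm{fl}(x)-x|\le\mu|x|$, $\mathrm{fl}(\mathrm{fl}(x))=\mathrm{fl}(x)$ and $\mathrm{fl}(x/2)=\mathrm{fl}(x)/2$.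 Complex operations are carried out by the usual real formulas. The products by $\mathcal F^H$ and $\mathcal F$ are computed, separately for each position $(r,s)$ in the blocks, by the radix-2 Cooley–Tukey FFT in which each root of unity $\omega_s^{j}$ ($s\le q$, $0\le j<2^s$) is replaced by an approximation with error at most $\mu$ (and its conjugate by the conjugate approximation). In step (2), for the computed argument $V$, the computed exponential $\mathrm{fl}(e^V)$ has machine numbers as (real and imaginary parts of) entries and satisfies $\|\mathrm{fl}(e^{V})-e^{V}\|_\infty\le\mu\tau\|e^{V}\|_\infty$, where $\tau>0$ is a constant. **Theorem.** There is a block-vector $Y=(Y_k)_{k=0,\dots,n-1}$ with $\mathcal C(Y)=e^{\mathcal C(U)}$. Let $\widehat Y_k$ be the value of $Y_k$ provided by the algorithm above applied in floating point arithmetic with precision $\mu$, and let $\Delta_{Y_k}=Y_k-\widehat Y_k$. Then $$\|\Delta_{Y_k}\|_\infty\le \mu m\chi,\qquad k=0,\dots,n-1,$$ $$\chi=m n\gamma\log_2 n\,\max_{r,s,h}|(U_h)_{r,s}|+\gamma\sqrt n\log_2 n\,\max_h\|Y_h\|_\infty+\tau,$$ where $\gamma\doteq 4\sqrt2+1$,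 i.e. equality holds up to lower order terms in $\mu$. Precisely: for given $q,m,U,\tau$ there is a function $\gamma=\gamma(\mu)$ with $\gamma(\mu)=4\sqrt2+1+O(\mu)$ as $\mu\to0^+$ such that, for all sufficiently small $\mu>0$, the bound with $\gamma=\gamma(\mu)$ holds for every such arithmetic of precision $\mu$, every choice of approximate roots of unity, every choice of computed exponentials and every $k$. -/

import Mathlib

open Filter Topology Asymptotics

attribute [local instance] Matrix.linftyOpNormedAddCommGroup

noncomputable section

namespace CircExp

/-! ### Subgenerators, block-Toeplitz and block-circulant matrices -/

/-- A subgenerator: nonnegative off-diagonal entries, negative diagonal entries, nonpositive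
row sums. -/
structure IsSubgenerator {ι : Type*} [Fintype ι] (Q : Matrix ι ι ℝ) : Prop where
  offDiag_nonneg : ∀ i j, i ≠ j → 0 ≤ Q i j
  diag_neg : ∀ i, Q i i < 0
  rowSum_nonpos : ∀ i, ∑ j, Q i j ≤ 0

/-- The block-upper triangular block-Toeplitz matrix with first block-row
`[U 0, …, U (n - 1)]`. -/
def blockToeplitz {n m : ℕ} (U : Fin n → Matrix (Fin m) (Fin m) ℝ) :
    Matrix (Fin n × Fin m) (Fin n × Fin m) ℝ :=
  fun i j => if i.1 ≤ j.1 then U (j.1 - i.1) i.2 j.2 else 0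

/-- The block-circulant matrix with first block-row `[U 0, …, U (n - 1)]`: the block in position
`(i, j)` is `U (j - i mod n)` (subtraction in `Fin n` is modulo `n`). -/
def blockCirculant {n m : ℕ} (U : Fin n → Matrix (Fin m) (Fin m) ℂ) :
    Matrix (Fin n × Fin m) (Fin n × Fin m) ℂ :=
  fun i j => U (j.1 - i.1) i.2 j.2

/-- A real block-vector regarded as a complex one. -/
def toComplex {n m : ℕ} (U : Fin n → Matrix (Fin m) (Fin m) ℝ) :
    Fin n → Matrix (Fin m) (Fin m) ℂ :=
  fun h => (U h).map Complex.ofReal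

/-! ### Floating point arithmetic -/

/-- `fl` is the rounding map of a binary floating point arithmetic with precision `μ` (standard
model, no underflow or overflow): the relative rounding error is at most `μ`, rounded numbers are
not changed by rounding again, and rounding commutes with a change of the binary exponent.
The machine numbers are the fixed points of `fl`. -/
structure IsRounding (μ : ℝ) (fl : ℝ → ℝ) : Prop where
  rel_error : ∀ x, |fl x - x| ≤ μ * |x|
  idem : ∀ x, fl (fl x) = fl x
  half : ∀ x, fl (x / 2) = fl x / 2

/-- Complex machine numbers: real and imaginary parts are machine numbers. -/
def IsMachine (fl : ℝ → ℝ) (z : ℂ) : Prop := fl z.re = z.re ∧ fl z.im = z.im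

/-- Complex addition carried out in floating point arithmetic. -/
def addFl (fl : ℝ → ℝ) (x y : ℂ) : ℂ := ⟨fl (x.re + y.re), fl (x.im + y.im)⟩

/-- Complex subtraction carried out in floating point arithmetic. -/
def subFl (fl : ℝ → ℝ) (x y : ℂ) : ℂ := ⟨fl (x.re - y.re), fl (x.im - y.im)⟩

/-- Complex multiplication carried out in floating point arithmetic:
four real products, one subtraction, one addition, each of them rounded. -/
def mulFl (fl : ℝ → ℝ) (x y : ℂ) : ℂ :=
  ⟨fl (fl (x.re * y.re) - fl (x.im * y.im)), fl (fl (x.re * y.im) + fl (x.im * y.re))⟩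

/-- Division of a complex number by a positive integer in floating point arithmetic. -/
def divFl (fl : ℝ → ℝ) (x : ℂ) (n : ℕ) : ℂ := ⟨fl (x.re / n), fl (x.im / n)⟩

/-- The number `ω ^ j`, where `ω = cos (2π / 2^s) + i sin (2π / 2^s)`. -/
def rootOfUnity (s j : ℕ) : ℂ :=
  Complex.exp (2 * Real.pi * Complex.I / (2 ^ s : ℕ)) ^ j

/-- `w` is a table of approximations, up to the error `ν`, of the roots of unity used by an FFT of
length `2 ^ q`; the entry `w s j` stands for `rootOfUnity s j`. -/
def IsRootTable (ν : ℝ) (q : ℕ) (w : ℕ → ℕ → ℂ) : Prop :=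
  ∀ s ≤ q, ∀ j < 2 ^ s, ‖w s j - rootOfUnity s j‖ ≤ ν

/-- The radix-2 Cooley-Tukey FFT of length `2 ^ q` in floating point arithmetic with the table `w`
of (approximate) roots of unity: the transforms `E`, `O` of the even- and odd-indexed entries are
combined by the butterflies `E k + w k * O k` and `E k - w k * O k`.
With exact arithmetic and exact roots it is the product by the Fourier matrix
`(ω ^ (i * j))`, and with the conjugate roots the product by its conjugate transpose. -/
def fftFl (fl : ℝ → ℝ) (w : ℕ → ℕ → ℂ) :
    (q : ℕ) → (Fin (2 ^ q) → ℂ) → Fin (2 ^ q) → ℂ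
  | 0, x => x
  | q + 1, x => fun k =>
      let E := fftFl fl w q fun j => x ⟨2 * j, by have := j.2; rw [pow_succ]; omega⟩
      let O := fftFl fl w q fun j => x ⟨2 * j + 1, by have := j.2; rw [pow_succ]; omega⟩
      if h : (k : ℕ) < 2 ^ q then
        addFl fl (E ⟨k, h⟩) (mulFl fl (w (q + 1) k) (O ⟨k, h⟩))
      else
        let l : Fin (2 ^ q) := ⟨k - 2 ^ q, by have := k.2; have := pow_succ 2 q; omega⟩
        subFl fl (E l) (mulFl fl (w (q + 1) l) (O l))

/-- The FFT applied to a block-vector: one scalar FFT for each position `(r, s)` of the blocks. -/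
def blockFftFl (fl : ℝ → ℝ) (w : ℕ → ℕ → ℂ) {q m : ℕ}
    (X : Fin (2 ^ q) → Matrix (Fin m) (Fin m) ℂ) : Fin (2 ^ q) → Matrix (Fin m) (Fin m) ℂ :=
  fun k => Matrix.of fun r s => fftFl fl w q (fun h => X h r s) k

/-- `W` is a floating point value of the exponential of the `m × m` matrix `V`, with error
bound `τ μ`. -/
structure IsExpFl {m : ℕ} (fl : ℝ → ℝ) (μ τ : ℝ) (V W : Matrix (Fin m) (Fin m) ℂ) : Prop where
  machine : ∀ r s, IsMachine fl (W r s)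
  error : ‖W - NormedSpace.exp V‖ ≤ μ * τ * ‖NormedSpace.exp V‖

/-- `Y` is a value provided, in floating point arithmetic, by the algorithm for the exponential of
a block-circulant matrix with first block-row `U`, of `n = 2 ^ q` blocks:
1. `V` is the (unnormalized) conjugate Fourier transform of `U`, computed by FFT;
2. `W k` is the computed exponential of `V k`;
3. `Y` is the Fourier transform of `W`, computed by FFT, divided by `n`. -/
def IsCircExpFl (fl : ℝ → ℝ) (w : ℕ → ℕ → ℂ) (μ τ : ℝ) {q m : ℕ}
    (U Y : Fin (2 ^ q) → Matrix (Fin m) (Fin m) ℂ) : Prop :=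
  ∃ V W : Fin (2 ^ q) → Matrix (Fin m) (Fin m) ℂ,
    V = blockFftFl fl (fun s j => starRingEnd ℂ (w s j)) U ∧
    (∀ k, IsExpFl fl μ τ (V k) (W k)) ∧
    ∀ k r s, Y k r s = divFl fl (blockFftFl fl w W k r s) (2 ^ q)

/-- The quantity
`χ = m n γ log₂ n max |(U_h)_{r,s}| + γ √n log₂ n max ‖Y_h‖_∞ + τ`. -/
def chi {n m : ℕ} (γ τ : ℝ) (U : Fin n → Matrix (Fin m) (Fin m) ℝ)
    (Y : Fin n → Matrix (Fin m) (Fin m) ℂ) : ℝ :=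
  m * n * γ * Real.logb 2 n * (⨆ h, ⨆ r, ⨆ s, |U h r s|)
    + γ * Real.sqrt n * Real.logb 2 n * (⨆ h, ‖Y h‖) + τ

end CircExp

end

namespace CircExp

/-! ### Rounding errors of complex operations -/

/-! The Fourier matrix block-diagonalises `C(U)` with blocks `V_k`, and passing from the blocks to
the block-circulant matrix is a continuous ring homomorphism, so it commutes with the exponential.
This produces `Y` and shows that the algorithm is right in exact arithmetic (`blockCirculant_exp`).

Errors have three sources. An exact butterfly is √2 times an isometry, so in the Euclidean norm an
FFT of length `2 ^ q` has relative error at most `(1 + κ) ^ q - 1`, with `κ = (2√2 + 2)μ + O(μ²)`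
(`l2_fftFl_sub_dft_le`); passing from entries to `‖·‖_∞` costs a factor `m`. The exponential
amplifies nothing to first order: the subgenerator property gives `‖V_k + cI‖ ≤ c`, hence `‖e^{V_k}‖
≤ 1`, and perturbing `V_k` by `d` moves the exponential by at most `e^d - 1`. The last transform,
divided by `n`, is an average with unimodular weights, so it passes on the inherited error
unamplified. Its own rounding error is proportional to the Euclidean size of the exponentials, which
Parseval turns into that of `Y`. Dividing by `n` is exact.

Because `2√2 + 2 < 6 < 4√2 + 1`, all second-order terms are absorbed for small `μ`, and a constant
`γ` suffices. -/

/-- The Euclidean norm of a complex vector. -/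
noncomputable def l2 {ι : Type*} [Fintype ι] (x : ι → ℂ) : ℝ :=
  ‖(WithLp.toLp 2 x : EuclideanSpace ℂ ι)‖

section l2

variable {ι : Type*} [Fintype ι]

theorem l2_nonneg (x : ι → ℂ) : 0 ≤ l2 x := norm_nonneg _

theorem l2_sq (x : ι → ℂ) : l2 x ^ 2 = ∑ i, ‖x i‖ ^ 2 :=
  EuclideanSpace.norm_sq_eq _

theorem l2_add_le (x y : ι → ℂ) : l2 (fun i => x i + y i) ≤ l2 x + l2 y :=
  norm_add_le (WithLp.toLp 2 x : EuclideanSpace ℂ ι) (WithLp.toLp 2 y)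

theorem norm_le_l2 (x : ι → ℂ) (i : ι) : ‖x i‖ ≤ l2 x :=
  PiLp.norm_apply_le (WithLp.toLp 2 x : EuclideanSpace ℂ ι) i

theorem l2_le_of_forall {x : ι → ℂ} {c : ℝ} (hc : 0 ≤ c) (h : ∀ i, ‖x i‖ ≤ c) :
    l2 x ≤ √(Fintype.card ι) * c := by
  refine le_of_sq_le_sq ?_ (by positivity)
  rw [l2_sq, mul_pow, Real.sq_sqrt (by positivity)]
  calc ∑ i, ‖x i‖ ^ 2 ≤ ∑ _i : ι, c ^ 2 :=
        Finset.sum_le_sum fun i _ => pow_le_pow_left₀ (norm_nonneg _) (h i) 2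
    _ = _ := by simp

end l2

theorem norm_le_of_re_im {z : ℂ} {a b c : ℝ} (h1 : |z.re| ≤ a) (h2 : |z.im| ≤ b)
    (hc : 0 ≤ c) (h : a ^ 2 + b ^ 2 ≤ c ^ 2) : ‖z‖ ≤ c := by
  refine le_of_sq_le_sq ?_ hc
  rw [Complex.sq_norm, Complex.normSq_apply]
  have h1' := pow_le_pow_left₀ (abs_nonneg _) h1 2
  have h2' := pow_le_pow_left₀ (abs_nonneg _) h2 2
  rw [sq_abs] at h1' h2'
  nlinarith

variable {μ : ℝ} {fl : ℝ → ℝ}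

theorem norm_fl_sub_le (hfl : IsRounding μ fl) (hμ : 0 ≤ μ) (z : ℂ) :
    ‖(⟨fl z.re, fl z.im⟩ : ℂ) - z‖ ≤ μ * ‖z‖ := by
  refine norm_le_of_re_im (hfl.rel_error z.re) (hfl.rel_error z.im) (by positivity) ?_
  rw [mul_pow, mul_pow, mul_pow, sq_abs, sq_abs, Complex.sq_norm, Complex.normSq_apply]
  exact le_of_eq (by ring)

theorem norm_addFl_sub_le (hfl : IsRounding μ fl) (hμ : 0 ≤ μ) (x y : ℂ) :
    ‖addFl fl x y - (x + y)‖ ≤ μ * ‖x + y‖ :=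
  norm_fl_sub_le hfl hμ (x + y)

theorem norm_subFl_sub_le (hfl : IsRounding μ fl) (hμ : 0 ≤ μ) (x y : ℂ) :
    ‖subFl fl x y - (x - y)‖ ≤ μ * ‖x - y‖ :=
  norm_fl_sub_le hfl hμ (x - y)

theorem abs_fl_add_sub_le (hfl : IsRounding μ fl) (hμ : 0 ≤ μ) {u v u' v' : ℝ}
    (hu : |u' - u| ≤ μ * |u|) (hv : |v' - v| ≤ μ * |v|) :
    |fl (u' + v') - (u + v)| ≤ (2 * μ + μ ^ 2) * (|u| + |v|) := by
  have h1 := hfl.rel_error (u' + v')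
  have h2 : |(u' + v') - (u + v)| ≤ μ * (|u| + |v|) := by
    calc |(u' + v') - (u + v)| = |(u' - u) + (v' - v)| := by ring_nf
      _ ≤ |u' - u| + |v' - v| := abs_add_le _ _
      _ ≤ _ := by linarith
  have h3 : |u' + v'| ≤ (1 + μ) * (|u| + |v|) := by
    calc |u' + v'| = |((u' + v') - (u + v)) + (u + v)| := by ring_nf
      _ ≤ |(u' + v') - (u + v)| + |u + v| := abs_add_le _ _
      _ ≤ _ := by linarith [abs_add_le u v]
  calc |fl (u' + v') - (u + v)|
        = |(fl (u' + v') - (u' + v')) + ((u' + v') - (u + v))| := by ring_nf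
    _ ≤ |fl (u' + v') - (u' + v')| + |(u' + v') - (u + v)| := abs_add_le _ _
    _ ≤ μ * ((1 + μ) * (|u| + |v|)) + μ * (|u| + |v|) :=
        add_le_add (h1.trans (mul_le_mul_of_nonneg_left h3 hμ)) h2
    _ = _ := by ring

/-- Each component passes through two roundings, whence `2μ + μ²`. The bound involves sums of
absolute values, so cancellation is lost; this is the origin of √2. -/
theorem norm_mulFl_sub_le (hfl : IsRounding μ fl) (hμ : 0 ≤ μ) (x y : ℂ) :
    ‖mulFl fl x y - x * y‖ ≤ √2 * (2 * μ + μ ^ 2) * (‖x‖ * ‖y‖) := by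
  have hre : |(mulFl fl x y - x * y).re| ≤
      (2 * μ + μ ^ 2) * (|x.re| * |y.re| + |x.im| * |y.im|) := by
    have h1 := hfl.rel_error (x.re * y.re)
    have h2 : |-fl (x.im * y.im) - -(x.im * y.im)| ≤ μ * |-(x.im * y.im)| := by
      rw [abs_neg, neg_sub_neg, abs_sub_comm]; exact hfl.rel_error _
    have h := abs_fl_add_sub_le hfl hμ h1 h2
    rwa [abs_neg, abs_mul, abs_mul, ← sub_eq_add_neg, ← sub_eq_add_neg] at h
  have him : |(mulFl fl x y - x * y).im| ≤
      (2 * μ + μ ^ 2) * (|x.re| * |y.im| + |x.im| * |y.re|) := by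
    have h := abs_fl_add_sub_le hfl hμ (hfl.rel_error (x.re * y.im))
      (hfl.rel_error (x.im * y.re))
    rwa [abs_mul, abs_mul] at h
  refine norm_le_of_re_im hre him (by positivity) ?_
  have hx := Complex.sq_norm x
  have hy := Complex.sq_norm y
  rw [Complex.normSq_apply, ← abs_mul_abs_self x.re, ← abs_mul_abs_self x.im] at hx
  rw [Complex.normSq_apply, ← abs_mul_abs_self y.re, ← abs_mul_abs_self y.im] at hy
  have key : (|x.re| * |y.re| + |x.im| * |y.im|) ^ 2 + (|x.re| * |y.im| + |x.im| * |y.re|) ^ 2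
      ≤ 2 * (‖x‖ ^ 2 * ‖y‖ ^ 2) := by
    rw [hx, hy]
    nlinarith [sq_nonneg (|x.re| * |y.re| - |x.im| * |y.im|),
      sq_nonneg (|x.re| * |y.im| - |x.im| * |y.re|)]
  calc _ = (2 * μ + μ ^ 2) ^ 2 * ((|x.re| * |y.re| + |x.im| * |y.im|) ^ 2
        + (|x.re| * |y.im| + |x.im| * |y.re|) ^ 2) := by ring
    _ ≤ (2 * μ + μ ^ 2) ^ 2 * (2 * (‖x‖ ^ 2 * ‖y‖ ^ 2)) :=
        mul_le_mul_of_nonneg_left key (by positivity)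
    _ = _ := by
        rw [mul_pow, mul_pow, Real.sq_sqrt (by norm_num)]; ring

/-- The relative error of the product by an approximate root of unity. -/
noncomputable def mulErr (μ : ℝ) : ℝ := √2 * (2 * μ + μ ^ 2) * (1 + μ) + μ

/-- The relative error of a butterfly. -/
noncomputable def stageErr (μ : ℝ) : ℝ := μ + (1 + μ) * mulErr μ

theorem mulErr_nonneg (hμ : 0 ≤ μ) : 0 ≤ mulErr μ := by unfold mulErr; positivity

theorem stageErr_nonneg (hμ : 0 ≤ μ) : 0 ≤ stageErr μ := by
  have := mulErr_nonneg hμ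
  unfold stageErr; positivity

theorem norm_mulFl_root_sub_le (hfl : IsRounding μ fl) (hμ : 0 ≤ μ) {w c : ℂ} (hc : ‖c‖ = 1)
    (hw : ‖w - c‖ ≤ μ) (y : ℂ) : ‖mulFl fl w y - c * y‖ ≤ mulErr μ * ‖y‖ := by
  have hw1 : ‖w‖ ≤ 1 + μ := by
    have := norm_le_norm_add_norm_sub' w c
    linarith
  calc ‖mulFl fl w y - c * y‖ = ‖(mulFl fl w y - w * y) + (w - c) * y‖ := by ring_nf
    _ ≤ ‖mulFl fl w y - w * y‖ + ‖w - c‖ * ‖y‖ := (norm_add_le _ _).trans (by rw [norm_mul])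
    _ ≤ √2 * (2 * μ + μ ^ 2) * ((1 + μ) * ‖y‖) + μ * ‖y‖ := by
        refine add_le_add ((norm_mulFl_sub_le hfl hμ w y).trans ?_) (by gcongr)
        gcongr
    _ = _ := by unfold mulErr; ring

theorem butterfly_error (hfl : IsRounding μ fl) (hμ : 0 ≤ μ) {w c : ℂ} (hc : ‖c‖ = 1)
    (hw : ‖w - c‖ ≤ μ) (a b : ℂ) :
    ‖addFl fl a (mulFl fl w b) - (a + c * b)‖ ^ 2 + ‖subFl fl a (mulFl fl w b) - (a - c * b)‖ ^ 2
      ≤ stageErr μ ^ 2 * (2 * (‖a‖ ^ 2 + ‖b‖ ^ 2)) := by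
  have ht := norm_mulFl_root_sub_le hfl hμ hc hw b
  have hM := mulErr_nonneg hμ
  set t := mulFl fl w b
  -- Here `p` is the exact output, `p'` the exact sum formed with the rounded product, and `s` the
  -- rounded sum.
  have aux : ∀ s p p' : ℂ, ‖p' - p‖ = ‖t - c * b‖ → ‖s - p'‖ ≤ μ * ‖p'‖ →
      ‖s - p‖ ≤ μ * ‖p‖ + (1 + μ) * mulErr μ * ‖b‖ := by
    intro s p p' h1 h2
    have h3 : ‖p'‖ ≤ ‖p‖ + mulErr μ * ‖b‖ := by
      have := norm_le_norm_add_norm_sub' p' p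
      linarith
    calc ‖s - p‖ ≤ ‖s - p'‖ + ‖p' - p‖ := norm_sub_le_norm_sub_add_norm_sub _ _ _
      _ ≤ μ * (‖p‖ + mulErr μ * ‖b‖) + mulErr μ * ‖b‖ :=
          add_le_add (h2.trans (mul_le_mul_of_nonneg_left h3 hμ)) (h1.le.trans ht)
      _ = _ := by ring
  have h1 := aux (addFl fl a t) (a + c * b) (a + t) (by congr 1; ring)
    (norm_addFl_sub_le hfl hμ a t)
  have h2 := aux (subFl fl a t) (a - c * b) (a - t)
    (by rw [← norm_neg]; congr 1; ring) (norm_subFl_sub_le hfl hμ a t)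
  have hpar := parallelogram_law_with_norm ℝ a (c * b)
  rw [norm_mul, hc, one_mul] at hpar
  have e1 := pow_le_pow_left₀ (norm_nonneg _) h1 2
  have e2 := pow_le_pow_left₀ (norm_nonneg _) h2 2
  set p := ‖a + c * b‖
  set r := ‖a - c * b‖
  have hp : 0 ≤ p := norm_nonneg _
  have hr : 0 ≤ r := norm_nonneg _
  have ha : 0 ≤ ‖a‖ := norm_nonneg _
  have hb : 0 ≤ ‖b‖ := norm_nonneg _
  set θ := (1 + μ) * mulErr μ
  have hθ0 : 0 ≤ θ := by positivity
  -- Cross term of the two squared bounds `(μp + θ‖b‖)²` and `(μr + θ‖b‖)²`. Using `p² + r² = 2(‖a‖²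
  -- + ‖b‖²)`, it fits into the square of `μ + θ`.
  have hcross : ‖b‖ * (p + r) ≤ 2 * (‖a‖ ^ 2 + ‖b‖ ^ 2) := by
    nlinarith [sq_nonneg (p - r), sq_nonneg (p + r - 2 * ‖b‖), sq_nonneg ‖a‖]
  have hcross' := mul_le_mul_of_nonneg_left hcross (by positivity : 0 ≤ 2 * μ * θ)
  have hb2 : θ ^ 2 * (2 * ‖b‖ ^ 2) ≤ θ ^ 2 * (2 * (‖a‖ ^ 2 + ‖b‖ ^ 2)) := by
    gcongr; nlinarith
  have hpr : μ ^ 2 * (p ^ 2 + r ^ 2) = μ ^ 2 * (2 * (‖a‖ ^ 2 + ‖b‖ ^ 2)) := by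
    rw [hpar]
  have : stageErr μ = μ + θ := rfl
  rw [this]
  nlinarith

/-! ### The exact Fourier transform and its radix-2 recursion -/

/-- `ζ s` is a primitive root of unity of order `2 ^ s`, coherently in `s`. -/
structure IsRootSystem (ζ : ℕ → ℂ) : Prop where
  norm_one : ∀ s, ‖ζ s‖ = 1
  sq : ∀ s, ζ (s + 1) ^ 2 = ζ s
  half : ∀ s, ζ (s + 1) ^ (2 ^ s) = -1

/-- The Fourier transform of length `2 ^ q` with respect to the root of unity `ζ q`. -/
noncomputable def dft (ζ : ℕ → ℂ) (q : ℕ) (x : Fin (2 ^ q) → ℂ) : Fin (2 ^ q) → ℂ :=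
  fun k => ∑ j : Fin (2 ^ q), ζ q ^ ((k : ℕ) * j) * x j

section halves

variable {q : ℕ}

/-- The index `2 j`. -/
def evenIdx (j : Fin (2 ^ q)) : Fin (2 ^ (q + 1)) :=
  ⟨2 * j, by have := j.2; rw [pow_succ]; omega⟩

/-- The index `2 j + 1`. -/
def oddIdx (j : Fin (2 ^ q)) : Fin (2 ^ (q + 1)) :=
  ⟨2 * j + 1, by have := j.2; rw [pow_succ]; omega⟩

/-- The index `k`, in the lower half. -/
def lowIdx (k : Fin (2 ^ q)) : Fin (2 ^ (q + 1)) :=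
  ⟨k, by have := k.2; rw [pow_succ]; omega⟩

/-- The index `k + 2 ^ q`, in the upper half. -/
def highIdx (k : Fin (2 ^ q)) : Fin (2 ^ (q + 1)) :=
  ⟨k + 2 ^ q, by have := k.2; rw [pow_succ]; omega⟩

theorem sum_even_odd {M : Type*} [AddCommMonoid M] (f : Fin (2 ^ (q + 1)) → M) :
    ∑ k, f k = ∑ j, f (evenIdx j) + ∑ j, f (oddIdx j) := by
  have hb : Function.Bijective (Sum.elim evenIdx oddIdx :
      Fin (2 ^ q) ⊕ Fin (2 ^ q) → Fin (2 ^ (q + 1))) := by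
    constructor
    · rintro (a | a) (b | b) h <;> simp [evenIdx, oddIdx, Fin.ext_iff] at h ⊢ <;> omega
    · intro k
      have hk : (k : ℕ) < 2 ^ q * 2 := by have := k.2; rwa [← pow_succ]
      rcases Nat.even_or_odd' (k : ℕ) with ⟨c, hc | hc⟩
      · exact ⟨Sum.inl ⟨c, by omega⟩, Fin.ext hc.symm⟩
      · exact ⟨Sum.inr ⟨c, by omega⟩, Fin.ext hc.symm⟩
  rw [← Function.Bijective.sum_comp hb f, Fintype.sum_sum_type]
  rfl

theorem sum_low_high {M : Type*} [AddCommMonoid M] (f : Fin (2 ^ (q + 1)) → M) :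
    ∑ k, f k = ∑ k, (f (lowIdx k) + f (highIdx k)) := by
  have hb : Function.Bijective (Sum.elim lowIdx highIdx :
      Fin (2 ^ q) ⊕ Fin (2 ^ q) → Fin (2 ^ (q + 1))) := by
    constructor
    · rintro (a | a) (b | b) h <;> have ha := a.2 <;> have hb := b.2 <;>
        simp [lowIdx, highIdx, Fin.ext_iff] at h ⊢ <;> omega
    · intro k
      have hk : (k : ℕ) < 2 ^ q * 2 := by have := k.2; rwa [← pow_succ]
      by_cases h : (k : ℕ) < 2 ^ q
      · exact ⟨Sum.inl ⟨k, h⟩, rfl⟩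
      · exact ⟨Sum.inr ⟨k - 2 ^ q, by omega⟩, Fin.ext (by simp [highIdx]; omega)⟩
  rw [← Function.Bijective.sum_comp hb f, Fintype.sum_sum_type, Finset.sum_add_distrib]
  rfl

theorem l2_sq_even_odd (x : Fin (2 ^ (q + 1)) → ℂ) :
    l2 x ^ 2 = l2 (fun j => x (evenIdx j)) ^ 2 + l2 (fun j => x (oddIdx j)) ^ 2 := by
  simp only [l2_sq, sum_even_odd]

theorem l2_sq_low_high (x : Fin (2 ^ (q + 1)) → ℂ) :
    l2 x ^ 2 = ∑ k, (‖x (lowIdx k)‖ ^ 2 + ‖x (highIdx k)‖ ^ 2) := by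
  rw [l2_sq, sum_low_high]

theorem l2_sq_butterfly {y : Fin (2 ^ (q + 1)) → ℂ} {a b c : Fin (2 ^ q) → ℂ}
    (hc : ∀ k, ‖c k‖ = 1) (h1 : ∀ k, y (lowIdx k) = a k + c k * b k)
    (h2 : ∀ k, y (highIdx k) = a k - c k * b k) :
    l2 y ^ 2 = 2 * (l2 a ^ 2 + l2 b ^ 2) := by
  rw [l2_sq_low_high, l2_sq, l2_sq, ← Finset.sum_add_distrib, Finset.mul_sum]
  refine Finset.sum_congr rfl fun k _ => ?_
  have hpar := parallelogram_law_with_norm ℝ (a k) (c k * b k)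
  rw [norm_mul, hc, one_mul] at hpar
  rw [h1, h2]
  linarith

theorem IsRootSystem.pow_low {ζ : ℕ → ℂ} (hζ : IsRootSystem ζ) (q k j : ℕ) :
    ζ (q + 1) ^ (k * (2 * j)) = ζ q ^ (k * j) := by
  rw [← hζ.sq q, ← pow_mul]
  congr 1; ring

theorem IsRootSystem.pow_high {ζ : ℕ → ℂ} (hζ : IsRootSystem ζ) (q k i : ℕ) :
    ζ (q + 1) ^ ((k + 2 ^ q) * i) = (-1) ^ i * ζ (q + 1) ^ (k * i) := by
  rw [add_mul, pow_add, pow_mul _ (2 ^ q), hζ.half, mul_comm]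

theorem dft_low {ζ : ℕ → ℂ} (hζ : IsRootSystem ζ) (x : Fin (2 ^ (q + 1)) → ℂ)
    (k : Fin (2 ^ q)) :
    dft ζ (q + 1) x (lowIdx k) = dft ζ q (fun j => x (evenIdx j)) k
      + ζ (q + 1) ^ (k : ℕ) * dft ζ q (fun j => x (oddIdx j)) k := by
  unfold dft
  rw [sum_even_odd, Finset.mul_sum]
  congr 1 <;> refine Finset.sum_congr rfl fun j _ => ?_
  · simp only [lowIdx, evenIdx, hζ.pow_low]
  · simp only [lowIdx, oddIdx]
    rw [mul_add, mul_one, pow_add, hζ.pow_low]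
    ring

theorem dft_high {ζ : ℕ → ℂ} (hζ : IsRootSystem ζ) (x : Fin (2 ^ (q + 1)) → ℂ)
    (k : Fin (2 ^ q)) :
    dft ζ (q + 1) x (highIdx k) = dft ζ q (fun j => x (evenIdx j)) k
      - ζ (q + 1) ^ (k : ℕ) * dft ζ q (fun j => x (oddIdx j)) k := by
  unfold dft
  rw [sum_even_odd, Finset.mul_sum, sub_eq_add_neg, ← Finset.sum_neg_distrib]
  congr 1 <;> refine Finset.sum_congr rfl fun j _ => ?_
  · simp [highIdx, evenIdx, hζ.pow_high, hζ.pow_low]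
  · simp only [highIdx, oddIdx]
    rw [hζ.pow_high, mul_add, mul_one, pow_add (ζ _), hζ.pow_low, pow_succ, pow_mul]
    ring_nf

theorem fftFl_low (w : ℕ → ℕ → ℂ) (x : Fin (2 ^ (q + 1)) → ℂ) (k : Fin (2 ^ q)) :
    fftFl fl w (q + 1) x (lowIdx k) = addFl fl (fftFl fl w q (fun j => x (evenIdx j)) k)
      (mulFl fl (w (q + 1) k) (fftFl fl w q (fun j => x (oddIdx j)) k)) := by
  have h : ((lowIdx k : Fin (2 ^ (q + 1))) : ℕ) < 2 ^ q := k.2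
  rw [fftFl]
  simp only [h, dif_pos]
  rfl

theorem fftFl_high (w : ℕ → ℕ → ℂ) (x : Fin (2 ^ (q + 1)) → ℂ) (k : Fin (2 ^ q)) :
    fftFl fl w (q + 1) x (highIdx k) = subFl fl (fftFl fl w q (fun j => x (evenIdx j)) k)
      (mulFl fl (w (q + 1) k) (fftFl fl w q (fun j => x (oddIdx j)) k)) := by
  have h : ¬ ((highIdx k : Fin (2 ^ (q + 1))) : ℕ) < 2 ^ q := by simp [highIdx]
  have h2 : (⟨(highIdx k : ℕ) - 2 ^ q, by simp [highIdx]⟩ : Fin (2 ^ q)) = k :=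
    Fin.ext (by simp [highIdx])
  rw [fftFl]
  simp only [h, dif_neg, not_false_eq_true, h2]
  simp only [highIdx, Nat.add_sub_cancel]
  rfl

end halves

/-! ### Parseval identity and normwise error of the FFT. -/

theorem l2_dft {ζ : ℕ → ℂ} (hζ : IsRootSystem ζ) :
    ∀ (q : ℕ) (x : Fin (2 ^ q) → ℂ), l2 (dft ζ q x) ^ 2 = 2 ^ q * l2 x ^ 2
  | 0, x => by simp [l2_sq, dft]
  | q + 1, x => by
    rw [l2_sq_butterfly (c := fun k => ζ (q + 1) ^ (k : ℕ)) (by simp [hζ.norm_one])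
      (dft_low hζ x) (dft_high hζ x), l2_dft hζ q, l2_dft hζ q, l2_sq_even_odd x]
    ring

theorem l2_dft_eq {ζ : ℕ → ℂ} (hζ : IsRootSystem ζ) (q : ℕ) (x : Fin (2 ^ q) → ℂ) :
    l2 (dft ζ q x) = √(2 ^ q) * l2 x := by
  refine (sq_eq_sq₀ (l2_nonneg _) (mul_nonneg (Real.sqrt_nonneg _) (l2_nonneg _))).1 ?_
  rw [l2_dft hζ, mul_pow, Real.sq_sqrt (by positivity)]

/-- Normwise error of the Cooley-Tukey FFT. -/
theorem l2_fftFl_sub_dft_le (hfl : IsRounding μ fl) (hμ : 0 ≤ μ) {ζ : ℕ → ℂ}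
    (hζ : IsRootSystem ζ) {w : ℕ → ℕ → ℂ} :
    ∀ (q : ℕ), (∀ s ≤ q, ∀ j < 2 ^ s, ‖w s j - ζ s ^ j‖ ≤ μ) → ∀ x : Fin (2 ^ q) → ℂ,
      l2 (fun k => fftFl fl w q x k - dft ζ q x k)
        ≤ ((1 + stageErr μ) ^ q - 1) * (√(2 ^ q) * l2 x)
  | 0, _, x => by
    have : (fun k => fftFl fl w 0 x k - dft ζ 0 x k) = 0 := by
      funext k
      have hk : k = 0 := Fin.ext (by simp)
      subst hk
      simp [fftFl, dft]
    rw [this]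
    simp [l2]
  | q + 1, hw, x => by
    have hκ := stageErr_nonneg hμ
    set κ := stageErr μ
    set ε := (1 + κ) ^ q - 1 with hε
    have hε0 : 0 ≤ ε := by
      have : 1 ≤ (1 + κ) ^ q := one_le_pow₀ (by linarith)
      linarith
    set xe := fun j => x (evenIdx j)
    set xo := fun j => x (oddIdx j)
    have IH := l2_fftFl_sub_dft_le hfl hμ hζ q (fun s hs => hw s (by omega))
    set N := √(2 ^ q)
    have hN0 : 0 ≤ N := Real.sqrt_nonneg _
    have hcomp : ∀ z : Fin (2 ^ q) → ℂ, l2 (fftFl fl w q z) ≤ (1 + ε) * (N * l2 z) := by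
      intro z
      have h1 := l2_add_le (fun k => fftFl fl w q z k - dft ζ q z k) (dft ζ q z)
      simp only [sub_add_cancel] at h1
      rw [l2_dft_eq hζ] at h1
      linarith [IH z]
    have hc : ∀ k : Fin (2 ^ q), ‖ζ (q + 1) ^ (k : ℕ)‖ = 1 := by simp [hζ.norm_one]
    -- the exact butterflies applied to the computed half-length transforms
    let y : Fin (2 ^ (q + 1)) → ℂ := fun k =>
      if h : (k : ℕ) < 2 ^ q then
        fftFl fl w q xe ⟨k, h⟩ + ζ (q + 1) ^ (k : ℕ) * fftFl fl w q xo ⟨k, h⟩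
      else
        fftFl fl w q xe ⟨k - 2 ^ q, by have := k.2; have := pow_succ 2 q; omega⟩
          - ζ (q + 1) ^ ((k : ℕ) - 2 ^ q)
            * fftFl fl w q xo ⟨k - 2 ^ q, by have := k.2; have := pow_succ 2 q; omega⟩
    have hy1 : ∀ k, y (lowIdx k) = fftFl fl w q xe k + ζ (q + 1) ^ (k : ℕ) * fftFl fl w q xo k := by
      intro k
      simp [y, lowIdx]
    have hy2 : ∀ k, y (highIdx k)
        = fftFl fl w q xe k - ζ (q + 1) ^ (k : ℕ) * fftFl fl w q xo k := by
      intro k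
      simp [y, highIdx]
    have hsplit := l2_sq_even_odd x
    have hround : l2 (fun k => fftFl fl w (q + 1) x k - y k)
        ≤ κ * (√2 * ((1 + ε) * (N * l2 x))) := by
      refine le_of_sq_le_sq ?_ (by have := l2_nonneg x; positivity)
      rw [l2_sq_low_high]
      calc _ ≤ ∑ k, κ ^ 2 * (2 * (‖fftFl fl w q xe k‖ ^ 2 + ‖fftFl fl w q xo k‖ ^ 2)) := by
            refine Finset.sum_le_sum fun k _ => ?_
            rw [hy1, hy2, fftFl_low, fftFl_high]
            exact butterfly_error hfl hμ (hc k)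
              (hw (q + 1) le_rfl k (by have := k.2; rw [pow_succ]; omega)) _ _
        _ = κ ^ 2 * (2 * (l2 (fftFl fl w q xe) ^ 2 + l2 (fftFl fl w q xo) ^ 2)) := by
            rw [l2_sq, l2_sq, ← Finset.sum_add_distrib, Finset.mul_sum, Finset.mul_sum]
        _ ≤ κ ^ 2 * (2 * (((1 + ε) * (N * l2 xe)) ^ 2 + ((1 + ε) * (N * l2 xo)) ^ 2)) := by
            have h1 := pow_le_pow_left₀ (l2_nonneg _) (hcomp xe) 2
            have h2 := pow_le_pow_left₀ (l2_nonneg _) (hcomp xo) 2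
            gcongr
        _ = _ := by
            rw [mul_pow κ, mul_pow √2, Real.sq_sqrt (by norm_num), mul_pow (1 + ε), mul_pow N,
              mul_pow (1 + ε), mul_pow N, mul_pow (1 + ε), mul_pow N, hsplit]
            ring
    -- The difference is itself an exact butterfly of the half-length errors, so they are only
    -- scaled by √2.
    have hprop : l2 (fun k => y k - dft ζ (q + 1) x k) ≤ √2 * (ε * (N * l2 x)) := by
      refine le_of_sq_le_sq ?_ (by have := l2_nonneg x; positivity)
      rw [l2_sq_butterfly (c := fun k => ζ (q + 1) ^ (k : ℕ))
        (a := fun k => fftFl fl w q xe k - dft ζ q xe k)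
        (b := fun k => fftFl fl w q xo k - dft ζ q xo k) hc
        (fun k => by rw [hy1, dft_low hζ]; ring) (fun k => by rw [hy2, dft_high hζ]; ring)]
      have h1 := pow_le_pow_left₀ (l2_nonneg _) (IH xe) 2
      have h2 := pow_le_pow_left₀ (l2_nonneg _) (IH xo) 2
      calc _ ≤ 2 * ((ε * (N * l2 xe)) ^ 2 + (ε * (N * l2 xo)) ^ 2) := by gcongr
        _ = _ := by
            rw [mul_pow √2, Real.sq_sqrt (by norm_num), mul_pow ε, mul_pow N, mul_pow ε,
              mul_pow N, mul_pow ε, mul_pow N, hsplit]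
            ring
    have htri := l2_add_le (fun k => fftFl fl w (q + 1) x k - y k)
      (fun k => y k - dft ζ (q + 1) x k)
    simp only [sub_add_sub_cancel] at htri
    have hN2 : √(2 ^ (q + 1)) = √2 * N := by
      rw [pow_succ, mul_comm, Real.sqrt_mul (by norm_num)]
    calc _ ≤ κ * (√2 * ((1 + ε) * (N * l2 x))) + √2 * (ε * (N * l2 x)) := by linarith
      -- The recursion is `κ(1 + ε) + ε = (1 + κ)(1 + ε) - 1`.
      _ = _ := by rw [hN2, pow_succ (1 + κ), show (1 + κ) ^ q = 1 + ε by rw [hε]; ring]; ring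

/-! ### Perturbation of the exponential -/

section exp

variable {𝔸 : Type*} [NormedRing 𝔸]

/-- Keeping the factor `D` makes the case `k = 0` true without `‖1‖ = 1`. -/
theorem norm_pow_mul_le {A D : 𝔸} {a d : ℝ} (ha : 0 ≤ a) (hA : ‖A‖ ≤ a) (hD : ‖D‖ ≤ d) :
    ∀ k : ℕ, ‖A ^ k * D‖ ≤ a ^ k * d
  | 0 => by simpa using hD
  | k + 1 => by
    rw [pow_succ', mul_assoc, pow_succ', mul_assoc]
    exact (norm_mul_le _ _).trans
      (mul_le_mul hA (norm_pow_mul_le ha hA hD k) (norm_nonneg _) ha)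

theorem norm_add_pow_sub_pow_le {A D : 𝔸} {a d : ℝ} (hA : ‖A‖ ≤ a) (hD : ‖D‖ ≤ d) :
    ∀ k : ℕ, ‖(A + D) ^ k - A ^ k‖ ≤ (a + d) ^ k - a ^ k
  | 0 => by simp
  | k + 1 => by
    have ha := (norm_nonneg _).trans hA
    have h1 : (A + D) ^ (k + 1) - A ^ (k + 1) = ((A + D) ^ k - A ^ k) * (A + D) + A ^ k * D := by
      rw [pow_succ, pow_succ, sub_mul, mul_add (A ^ k)]; abel
    have hAD : ‖A + D‖ ≤ a + d := (norm_add_le _ _).trans (add_le_add hA hD)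
    have IH := norm_add_pow_sub_pow_le hA hD k
    calc ‖(A + D) ^ (k + 1) - A ^ (k + 1)‖
          ≤ ‖(A + D) ^ k - A ^ k‖ * ‖A + D‖ + ‖A ^ k * D‖ := by
          rw [h1]
          exact (norm_add_le _ _).trans (add_le_add (norm_mul_le _ _) le_rfl)
      _ ≤ ((a + d) ^ k - a ^ k) * (a + d) + a ^ k * d :=
          add_le_add (mul_le_mul IH hAD (norm_nonneg _) ((norm_nonneg _).trans IH))
            (norm_pow_mul_le ha hA hD k)
      _ = _ := by ring

variable [NormedAlgebra ℂ 𝔸] [CompleteSpace 𝔸]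

theorem hasSum_real_exp (a : ℝ) : HasSum (fun k : ℕ => (k.factorial : ℝ)⁻¹ * a ^ k)
    (Real.exp a) := by
  rw [Real.exp_eq_exp_ℝ]
  exact NormedSpace.exp_series_hasSum_exp' (𝕂 := ℝ) a

/-- The power series is majorised term by term by the scalar one; `A` and `D` need not commute. -/
theorem norm_exp_add_sub_exp_le {A D : 𝔸} {a d : ℝ} (hA : ‖A‖ ≤ a) (hD : ‖D‖ ≤ d) :
    ‖NormedSpace.exp (A + D) - NormedSpace.exp A‖ ≤ Real.exp (a + d) - Real.exp a := by
  have h1 := (NormedSpace.exp_series_hasSum_exp' (𝕂 := ℂ) (A + D)).sub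
    (NormedSpace.exp_series_hasSum_exp' (𝕂 := ℂ) A)
  have h2 := (hasSum_real_exp (a + d)).sub (hasSum_real_exp a)
  refine h1.norm_le_of_bounded h2 fun k => ?_
  rw [← smul_sub, norm_smul, ← mul_sub, norm_inv, Complex.norm_natCast]
  exact mul_le_mul_of_nonneg_left (norm_add_pow_sub_pow_le hA hD k) (by positivity)

theorem norm_exp_le [NormOneClass 𝔸] {A : 𝔸} {a : ℝ} (hA : ‖A‖ ≤ a) :
    ‖NormedSpace.exp A‖ ≤ Real.exp a := by
  refine (NormedSpace.exp_series_hasSum_exp' (𝕂 := ℂ) A).norm_le_of_bounded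
    (hasSum_real_exp a) fun k => ?_
  rw [norm_smul, norm_inv, Complex.norm_natCast]
  exact mul_le_mul_of_nonneg_left
    ((norm_pow_le A k).trans (pow_le_pow_left₀ (norm_nonneg _) hA k)) (by positivity)

theorem exp_eq_smul_exp_add (V : 𝔸) (c : ℝ) :
    NormedSpace.exp V = (Real.exp (-c) : ℂ) • NormedSpace.exp (V + (c : ℂ) • (1 : 𝔸)) := by
  let _ : NormedAlgebra ℚ 𝔸 := NormedAlgebra.restrictScalars ℚ ℂ 𝔸
  have hcomm : Commute (algebraMap ℂ 𝔸 (-(c : ℂ))) (V + (c : ℂ) • (1 : 𝔸)) :=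
    Algebra.commutes _ _
  have h := NormedSpace.exp_add_of_commute hcomm
  rw [← NormedSpace.algebraMap_exp_comm, ← Complex.exp_eq_exp_ℂ, ← Algebra.smul_def] at h
  rw [Complex.ofReal_exp, Complex.ofReal_neg, ← h, Algebra.algebraMap_eq_smul_one]
  congr 1
  module

variable {V : 𝔸} {c : ℝ}

theorem norm_exp_le_one [NormOneClass 𝔸] (hV : ‖V + (c : ℂ) • (1 : 𝔸)‖ ≤ c) :
    ‖NormedSpace.exp V‖ ≤ 1 := by
  rw [exp_eq_smul_exp_add V c, norm_smul, Complex.norm_real, Real.norm_eq_abs, Real.abs_exp]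
  calc _ ≤ Real.exp (-c) * Real.exp c :=
        mul_le_mul_of_nonneg_left (norm_exp_le hV) (Real.exp_nonneg _)
    _ = 1 := by rw [← Real.exp_add]; simp

/-- The scalar shift contributes `e^{-c}`, which cancels the `e^c` of the crude bound, so the result
does not depend on the size of `V`. -/
theorem norm_exp_add_sub_exp_le_of_shift {D : 𝔸} {d : ℝ}
    (hV : ‖V + (c : ℂ) • (1 : 𝔸)‖ ≤ c) (hD : ‖D‖ ≤ d) :
    ‖NormedSpace.exp (V + D) - NormedSpace.exp V‖ ≤ Real.exp d - 1 := by
  rw [exp_eq_smul_exp_add V c, exp_eq_smul_exp_add (V + D) c, ← smul_sub, norm_smul,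
    Complex.norm_real, Real.norm_eq_abs, Real.abs_exp, add_right_comm]
  calc _ ≤ Real.exp (-c) * (Real.exp (c + d) - Real.exp c) :=
        mul_le_mul_of_nonneg_left (norm_exp_add_sub_exp_le hV hD) (Real.exp_nonneg _)
    _ = Real.exp d - 1 := by
        rw [mul_sub, ← Real.exp_add, ← Real.exp_add]; simp

end exp

/-! ### Roots of unity and block-circulant matrices -/

/-- The primitive root of unity `exp (2π i / 2 ^ s)`. -/
noncomputable def unitRoot (s : ℕ) : ℂ := Complex.exp (2 * Real.pi * Complex.I / (2 ^ s : ℕ))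

theorem isPrimitiveRoot_unitRoot (s : ℕ) : IsPrimitiveRoot (unitRoot s) (2 ^ s) :=
  Complex.isPrimitiveRoot_exp _ (by positivity)

theorem norm_unitRoot (s : ℕ) : ‖unitRoot s‖ = 1 :=
  (isPrimitiveRoot_unitRoot s).norm'_eq_one (by positivity)

theorem isRootSystem_unitRoot : IsRootSystem unitRoot where
  norm_one := norm_unitRoot
  sq s := by
    unfold unitRoot
    rw [← Complex.exp_nat_mul, pow_succ]
    congr 1
    push_cast
    field_simp
  half s := by
    have h := (isPrimitiveRoot_unitRoot (s + 1)).pow (a := 2 ^ s) (b := 2) (by positivity)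
      (pow_succ 2 s)
    exact h.eq_neg_one_of_two_right

theorem isRootSystem_conj {ζ : ℕ → ℂ} (hζ : IsRootSystem ζ) :
    IsRootSystem fun s => starRingEnd ℂ (ζ s) where
  norm_one s := by rw [RCLike.norm_conj, hζ.norm_one]
  sq s := by rw [← map_pow, hζ.sq]
  half s := by rw [← map_pow, hζ.half]; simp

theorem conj_unitRoot (s : ℕ) : starRingEnd ℂ (unitRoot s) = (unitRoot s)⁻¹ := by
  rw [Complex.inv_def, Complex.normSq_eq_norm_sq, norm_unitRoot]; simp

/-- Orthogonality of the powers of a primitive root of unity. -/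
theorem sum_root_mul_inv {n : ℕ} {ζ : ℂ} (hζ : IsPrimitiveRoot ζ n) (i j : Fin n) :
    ∑ l : Fin n, ζ ^ ((l : ℕ) * i) * ζ⁻¹ ^ ((l : ℕ) * j) = if i = j then (n : ℂ) else 0 := by
  have hn : n ≠ 0 := fun h => by subst h; exact i.elim0
  have h0 : ζ ≠ 0 := hζ.ne_zero hn
  have hterm : ∀ l : Fin n, ζ ^ ((l : ℕ) * i) * ζ⁻¹ ^ ((l : ℕ) * j)
      = (ζ ^ (i : ℕ) * ζ⁻¹ ^ (j : ℕ)) ^ (l : ℕ) := fun l => by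
    rw [mul_pow, ← pow_mul, ← pow_mul, mul_comm (i : ℕ), mul_comm (j : ℕ)]
  simp_rw [hterm]
  split_ifs with h
  · subst h
    simp [inv_pow, h0]
  · set u := ζ ^ (i : ℕ) * ζ⁻¹ ^ (j : ℕ) with hu_def
    have hu : u ≠ 1 := by
      intro hu
      rw [hu_def, inv_pow, mul_inv_eq_one₀ (pow_ne_zero _ h0)] at hu
      exact h (Fin.ext (hζ.pow_inj i.2 j.2 hu))
    have hun : u ^ n = 1 := by
      rw [hu_def, mul_pow, ← pow_mul, ← pow_mul, mul_comm (i : ℕ), mul_comm (j : ℕ), pow_mul,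
        pow_mul, inv_pow, hζ.pow_eq_one]
      simp
    rw [Fin.sum_univ_eq_sum_range (fun l => u ^ l), geom_sum_eq hu, hun]
    simp

/-! ### Block-circulant matrices in the Fourier basis. -/

section circulant

open scoped Kronecker Matrix.Norms.Operator

variable {n m : ℕ}

/-- The spectral projections of the circulant matrices. -/
noncomputable def circProj (ζ : ℂ) (h : Fin n) : Matrix (Fin n) (Fin n) ℂ :=
  Matrix.of fun i j => (n : ℂ)⁻¹ * (ζ ^ ((h : ℕ) * j) * ζ⁻¹ ^ ((h : ℕ) * i))

theorem circProj_mul {ζ : ℂ} (hζ : IsPrimitiveRoot ζ n) (h h' : Fin n) :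
    circProj ζ h * circProj ζ h' = if h = h' then circProj ζ h else 0 := by
  have hn : (n : ℂ) ≠ 0 := by
    rw [Nat.cast_ne_zero]
    exact fun h0 => by subst h0; exact h.elim0
  ext i j
  rw [Matrix.mul_apply]
  have hs := sum_root_mul_inv hζ h h'
  calc _ = (n : ℂ)⁻¹ * (n : ℂ)⁻¹ * (ζ ^ ((h' : ℕ) * j) * ζ⁻¹ ^ ((h : ℕ) * i))
        * ∑ l : Fin n, ζ ^ ((l : ℕ) * h) * ζ⁻¹ ^ ((l : ℕ) * h') := by
        rw [Finset.mul_sum]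
        refine Finset.sum_congr rfl fun l _ => ?_
        simp only [circProj, Matrix.of_apply]
        rw [mul_comm (h : ℕ) l, mul_comm (h' : ℕ) l]
        ring
    _ = _ := by
        rw [hs]
        split_ifs with e
        · subst e
          simp only [circProj, Matrix.of_apply]
          field_simp
        · simp

theorem sum_circProj {ζ : ℂ} (hζ : IsPrimitiveRoot ζ n) :
    ∑ h : Fin n, circProj ζ h = 1 := by
  ext i j
  have hn : (n : ℂ) ≠ 0 := by
    rw [Nat.cast_ne_zero]
    exact fun h0 => by subst h0; exact i.elim0
  rw [Matrix.sum_apply]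
  simp only [circProj, Matrix.of_apply]
  rw [← Finset.mul_sum, sum_root_mul_inv hζ, Matrix.one_apply]
  by_cases h : i = j
  · subst h; simp [hn]
  · simp [h, Ne.symm h]

/-- Block-circulant matrices as a function of their blocks in the Fourier basis. -/
noncomputable def circHom {ζ : ℂ} (hζ : IsPrimitiveRoot ζ n) (m : ℕ) :
    (Fin n → Matrix (Fin m) (Fin m) ℂ) →+* Matrix (Fin n × Fin m) (Fin n × Fin m) ℂ where
  toFun V := ∑ h, circProj ζ h ⊗ₖ V h
  map_one' := by
    rw [← Matrix.one_kronecker_one, ← sum_circProj hζ]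
    exact (map_sum (AddMonoidHom.mk' (fun A => A ⊗ₖ (1 : Matrix (Fin m) (Fin m) ℂ))
      fun _ _ => Matrix.add_kronecker _ _ _) _ _).symm
  map_mul' V W := by
    rw [Finset.sum_mul_sum]
    refine Finset.sum_congr rfl fun h _ => ?_
    rw [Finset.sum_eq_single h]
    · rw [← Matrix.mul_kronecker_mul, circProj_mul hζ, if_pos rfl]; rfl
    · intro h' _ hne
      rw [← Matrix.mul_kronecker_mul, circProj_mul hζ, if_neg hne.symm, Matrix.zero_kronecker]
    · simp
  map_zero' := by simp
  map_add' V W := by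
    rw [← Finset.sum_add_distrib]
    exact Finset.sum_congr rfl fun h _ => Matrix.kronecker_add _ _ _

theorem continuous_circHom {ζ : ℂ} (hζ : IsPrimitiveRoot ζ n) :
    Continuous (circHom hζ m) := by
  change Continuous fun V : Fin n → Matrix (Fin m) (Fin m) ℂ => ∑ h, circProj ζ h ⊗ₖ V h
  refine continuous_finsetSum _ fun h _ => continuous_matrix fun i j => ?_
  exact continuous_const.mul ((continuous_apply h).matrix_elem _ _)

theorem circHom_exp {ζ : ℂ} (hζ : IsPrimitiveRoot ζ n) (V : Fin n → Matrix (Fin m) (Fin m) ℂ) :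
    circHom hζ m (fun h => NormedSpace.exp (V h)) = NormedSpace.exp (circHom hζ m V) := by
  have h := NormedSpace.map_exp _ (continuous_circHom (m := m) hζ) V
  rw [Pi.exp_def] at h
  exact h

/-- Subtraction in `Fin n` wraps around, which is harmless for exponents of an `n`-th root of unity.
-/
theorem pow_mul_sub {ζ : ℂ} (hζ : ζ ^ n = 1) (h : ℕ) (i j : Fin n) :
    ζ ^ (h * ((j - i : Fin n) : ℕ)) = ζ ^ (h * j) * ζ⁻¹ ^ (h * i) := by
  have hn : n ≠ 0 := fun h0 => by subst h0; exact i.elim0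
  have h0 : ζ ≠ 0 := fun h0 => by simp [h0, hn] at hζ
  rw [inv_pow, eq_mul_inv_iff_mul_eq₀ (pow_ne_zero _ h0), ← pow_add, ← mul_add]
  refine pow_eq_pow_of_modEq (Nat.ModEq.mul_left _ ?_) hζ
  rw [Fin.sub_def]
  have := i.2
  calc (n - (i : ℕ) + j) % n + i ≡ (n - (i : ℕ) + j) + i [MOD n] :=
        (Nat.mod_modEq _ _).add_right _
    _ = n + j := by omega
    _ ≡ j [MOD n] := by simp [Nat.ModEq]

theorem blockCirculant_eq_circHom {ζ : ℂ} (hζ : IsPrimitiveRoot ζ n)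
    {X V : Fin n → Matrix (Fin m) (Fin m) ℂ}
    (hX : ∀ d r s, X d r s = (n : ℂ)⁻¹ * ∑ h : Fin n, ζ ^ ((d : ℕ) * h) * V h r s) :
    blockCirculant X = circHom hζ m V := by
  ext ⟨i, r⟩ ⟨j, s⟩
  change X (j - i) r s = (∑ h, circProj ζ h ⊗ₖ V h) (i, r) (j, s)
  rw [hX, Matrix.sum_apply, Finset.mul_sum]
  refine Finset.sum_congr rfl fun h _ => ?_
  rw [Matrix.kronecker_apply, mul_comm ((j - i : Fin n) : ℕ), pow_mul_sub hζ.pow_eq_one]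
  simp only [circProj, Matrix.of_apply]
  ring

end circulant

/-- The Fourier transform of a block-vector. -/
noncomputable def blockDft (ζ : ℕ → ℂ) {q m : ℕ}
    (X : Fin (2 ^ q) → Matrix (Fin m) (Fin m) ℂ) : Fin (2 ^ q) → Matrix (Fin m) (Fin m) ℂ :=
  fun k => Matrix.of fun r s => dft ζ q (fun h => X h r s) k

theorem dft_conj_dft {q : ℕ} (x : Fin (2 ^ q) → ℂ) (d : Fin (2 ^ q)) :
    dft unitRoot q (dft (fun s => starRingEnd ℂ (unitRoot s)) q x) d = (2 ^ q : ℕ) * x d := by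
  simp only [dft, conj_unitRoot, Finset.mul_sum]
  rw [Finset.sum_comm]
  have h := sum_root_mul_inv (isPrimitiveRoot_unitRoot q) d
  calc _ = ∑ j : Fin (2 ^ q), (∑ l : Fin (2 ^ q), unitRoot q ^ ((l : ℕ) * d) * (unitRoot q)⁻¹ ^ ((l : ℕ) * j))
        * x j := by
        refine Finset.sum_congr rfl fun j _ => ?_
        rw [Finset.sum_mul]
        refine Finset.sum_congr rfl fun l _ => ?_
        rw [mul_comm (d : ℕ)]; ring
    _ = _ := by simp only [h, ite_mul, zero_mul, Finset.sum_ite_eq, Finset.mem_univ, if_true]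

/-- The exponential of a block-circulant matrix. -/
theorem blockCirculant_exp {q m : ℕ} (X : Fin (2 ^ q) → Matrix (Fin m) (Fin m) ℂ) :
    blockCirculant (fun k => ((2 ^ q : ℕ) : ℂ)⁻¹ • blockDft unitRoot (fun h => NormedSpace.exp
      (blockDft (fun s => starRingEnd ℂ (unitRoot s)) X h)) k)
      = NormedSpace.exp (blockCirculant X) := by
  have hζ := isPrimitiveRoot_unitRoot q
  rw [blockCirculant_eq_circHom hζ (X := X)
    (V := blockDft (fun s => starRingEnd ℂ (unitRoot s)) X), ← circHom_exp]
  · exact blockCirculant_eq_circHom hζ fun d r s => rfl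
  · intro d r s
    have h := dft_conj_dft (fun h => X h r s) d
    rw [eq_inv_mul_iff_mul_eq₀ (Nat.cast_ne_zero.2 (by positivity)), ← h]
    rfl

/-! ### Subgenerators -/

theorem norm_le_of_rowSum_le {m : ℕ} {A : Matrix (Fin m) (Fin m) ℂ} {c : ℝ} (hc : 0 ≤ c)
    (h : ∀ r, ∑ s, ‖A r s‖ ≤ c) : ‖A‖ ≤ c := by
  rw [Matrix.linfty_opNorm_def]
  lift c to NNReal using hc
  rw [NNReal.coe_le_coe, Finset.sup_le_iff]
  intro r _
  rw [← NNReal.coe_le_coe]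
  simpa using h r

theorem rowSum_le_norm {m : ℕ} (A : Matrix (Fin m) (Fin m) ℂ) (r : Fin m) :
    ∑ s, ‖A r s‖ ≤ ‖A‖ := by
  rw [Matrix.linfty_opNorm_def]
  have h := Finset.le_sup (f := fun i => ∑ j, ‖A i j‖₊) (Finset.mem_univ r)
  rw [← NNReal.coe_le_coe] at h
  simpa using h

theorem entry_le_norm {m : ℕ} (A : Matrix (Fin m) (Fin m) ℂ) (r s : Fin m) : ‖A r s‖ ≤ ‖A‖ :=
  (Finset.single_le_sum (f := fun s => ‖A r s‖) (fun _ _ => norm_nonneg _)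
    (Finset.mem_univ s)).trans (rowSum_le_norm A r)

/-- Adding `cI` to `U 0` makes every entry in the first block-row of the Toeplitz matrix
nonnegative, with row sums at most `c`. Unimodular weights cannot increase these sums. For `c`, any
common bound of the `|U 0 r r|` would do. -/
theorem norm_blockDft_add_smul_le {q m : ℕ} {U : Fin (2 ^ q) → Matrix (Fin m) (Fin m) ℝ}
    (hU : IsSubgenerator (blockToeplitz U)) {ζ : ℕ → ℂ} (hζ : ∀ s, ‖ζ s‖ = 1)
    (k : Fin (2 ^ q)) :
    ‖blockDft ζ (toComplex U) k + ((∑ r, |U 0 r r| : ℝ) : ℂ) • (1 : Matrix (Fin m) (Fin m) ℂ)‖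
      ≤ ∑ r, |U 0 r r| := by
  set c := ∑ r, |U 0 r r|
  have hc0 : 0 ≤ c := Finset.sum_nonneg fun _ _ => abs_nonneg _
  have hT : ∀ j r s, blockToeplitz U (0, r) (j, s) = U j r s := by
    intro j r s
    simp [blockToeplitz]
  let U' : Fin (2 ^ q) → Fin m → Fin m → ℝ := fun j r s =>
    U j r s + if j = 0 then (if r = s then c else 0) else 0
  have hU' : ∀ j r s, 0 ≤ U' j r s := by
    intro j r s
    by_cases h : j = 0 ∧ r = s
    · obtain ⟨rfl, rfl⟩ := h
      have h1 : |U 0 r r| ≤ c :=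
        Finset.single_le_sum (f := fun r => |U 0 r r|) (fun _ _ => abs_nonneg _)
          (Finset.mem_univ r)
      simp only [U', if_true]
      linarith [neg_abs_le (U 0 r r)]
    · have h1 := hU.offDiag_nonneg (0, r) (j, s) fun e => by
        rw [Prod.mk.injEq] at e; exact h ⟨e.1.symm, e.2⟩
      rw [hT] at h1
      simp only [U']
      split_ifs <;> linarith
  refine norm_le_of_rowSum_le hc0 fun r => ?_
  have hrow := hU.rowSum_nonpos (0, r)
  rw [Fintype.sum_prod_type, Finset.sum_comm] at hrow
  simp only [hT] at hrow
  have hentry : ∀ s, (blockDft ζ (toComplex U) k + (c : ℂ) • (1 : Matrix (Fin m) (Fin m) ℂ)) r s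
      = ∑ j : Fin (2 ^ q), ζ q ^ ((k : ℕ) * j) * (U' j r s : ℂ) := by
    intro s
    simp only [U', Complex.ofReal_add, mul_add, Finset.sum_add_distrib]
    rw [Matrix.add_apply, Matrix.smul_apply, Matrix.one_apply]
    congr 1
    rw [Finset.sum_eq_single 0 (fun j _ hj => by simp [hj]) (by simp)]
    by_cases h : r = s <;> simp [h]
  calc _ ≤ ∑ s, ∑ j, U' j r s := by
        refine Finset.sum_le_sum fun s _ => ?_
        rw [hentry]
        refine (norm_sum_le _ _).trans (Finset.sum_le_sum fun j _ => ?_)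
        rw [norm_mul, norm_pow, hζ, one_pow, one_mul, Complex.norm_real, Real.norm_eq_abs,
          abs_of_nonneg (hU' j r s)]
    _ = ∑ s, ∑ j, U j r s + c := by
        simp [U', Finset.sum_add_distrib]
    _ ≤ c := by linarith

/-! ### First-order bounds for small precision -/

/-- The strict inequality `f' < K` is the room that swallows higher-order terms. -/
theorem eventually_le_of_hasDerivAt {f : ℝ → ℝ} {f' K : ℝ} (hf : HasDerivAt f f' 0)
    (h0 : f 0 = 0) (hK : f' < K) : ∀ᶠ μ in 𝓝[>] (0 : ℝ), f μ ≤ K * μ := by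
  have h := hf.tendsto_slope_zero_right
  filter_upwards [h.eventually (gt_mem_nhds hK), self_mem_nhdsWithin] with μ h1 hμ
  have hμ' : 0 < μ := hμ
  simp only [zero_add, h0, sub_zero, smul_eq_mul] at h1
  rw [inv_mul_lt_iff₀ hμ'] at h1
  linarith

theorem hasDerivAt_mulErr : HasDerivAt mulErr (2 * √2 + 1) 0 := by
  have hid := hasDerivAt_id (0 : ℝ)
  have h := ((((hid.const_mul 2).add (hid.pow 2)).const_mul √2).mul (hid.const_add 1)).add hid
  refine (h.congr_deriv ?_).congr_of_eventuallyEq ?_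
  · simp; ring
  · exact Eventually.of_forall fun μ => by simp [mulErr]

theorem hasDerivAt_stageErr : HasDerivAt stageErr (2 * √2 + 2) 0 := by
  have hid := hasDerivAt_id (0 : ℝ)
  have h := hid.add ((hid.const_add 1).mul hasDerivAt_mulErr)
  refine (h.congr_deriv ?_).congr_of_eventuallyEq ?_
  · simp [mulErr]; ring
  · exact Eventually.of_forall fun μ => by simp [stageErr]

theorem eventually_fftErr_le (q : ℕ) :
    ∀ᶠ μ in 𝓝[>] (0 : ℝ), (1 + stageErr μ) ^ q - 1 ≤ 6 * q * μ := by
  -- For `q = 0` the strict slope comparison fails, but both sides vanish.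
  rcases Nat.eq_zero_or_pos q with rfl | hq
  · simp
  have h0 : stageErr 0 = 0 := by simp [stageErr, mulErr]
  have h := ((hasDerivAt_stageErr.const_add 1).pow q).sub_const 1
  refine eventually_le_of_hasDerivAt h (by simp [h0]) ?_
  have hq' : (0 : ℝ) < q := by exact_mod_cast hq
  have h2 : √2 < 2 := by
    rw [Real.sqrt_lt' (by norm_num)]; norm_num
  simp only [h0, add_zero, one_pow, mul_one]
  nlinarith

theorem eventually_total_le {a b τ K : ℝ} (hK : a + τ < K) :
    ∀ᶠ μ in 𝓝[>] (0 : ℝ),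
      (Real.exp (a * μ) - 1 + μ * τ * Real.exp (a * μ))
        + b * μ * (Real.exp (a * μ) - 1 + μ * τ * Real.exp (a * μ)) ≤ K * μ := by
  have hid := hasDerivAt_id (0 : ℝ)
  have he := (hid.const_mul a).exp
  have hg := (he.sub_const 1).add ((hid.mul_const τ).mul he)
  have h := hg.add ((hid.const_mul b).mul hg)
  refine eventually_le_of_hasDerivAt h (by simp) ?_
  simpa using hK

/-! ### The error of the algorithm -/

variable {μ τ : ℝ} {fl : ℝ → ℝ} {q m : ℕ}

theorem IsRounding.div_two_pow (hfl : IsRounding μ fl) (x : ℝ) :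
    ∀ q : ℕ, fl (x / 2 ^ q) = fl x / 2 ^ q
  | 0 => by simp
  | q + 1 => by rw [pow_succ, ← div_div, hfl.half, hfl.div_two_pow x q, div_div]

theorem IsRounding.divFl_two_pow (hfl : IsRounding μ fl) {z : ℂ} (hz : IsMachine fl z) (q : ℕ) :
    divFl fl z (2 ^ q) = ((2 ^ q : ℕ) : ℂ)⁻¹ * z := by
  have h : ((2 ^ q : ℕ) : ℂ)⁻¹ = (((2 ^ q : ℝ)⁻¹ : ℝ) : ℂ) := by push_cast; rfl
  rw [h]
  unfold divFl
  push_cast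
  rw [hfl.div_two_pow, hfl.div_two_pow, hz.1, hz.2]
  apply Complex.ext
  · simp [← Complex.ofReal_ofNat, ← Complex.ofReal_pow, ← Complex.ofReal_inv, div_eq_inv_mul]
  · simp [← Complex.ofReal_ofNat, ← Complex.ofReal_pow, ← Complex.ofReal_inv, div_eq_inv_mul]

/-- Outputs are results of rounding, except for `q = 0`, where the input is returned; hence the
assumption on `x`. It makes the final division exact. -/
theorem IsRounding.isMachine_fftFl (hfl : IsRounding μ fl) (w : ℕ → ℕ → ℂ) :
    ∀ (q : ℕ) (x : Fin (2 ^ q) → ℂ), (∀ j, IsMachine fl (x j)) →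
      ∀ k, IsMachine fl (fftFl fl w q x k)
  | 0, _, hx, k => hx k
  | q + 1, x, _, k => by
    rw [fftFl]
    dsimp only
    split_ifs
    · exact ⟨hfl.idem _, hfl.idem _⟩
    · exact ⟨hfl.idem _, hfl.idem _⟩

theorem norm_fftFl_sub_dft_le (hfl : IsRounding μ fl) (hμ : 0 ≤ μ)
    (hsmall : (1 + stageErr μ) ^ q - 1 ≤ 6 * q * μ) {ζ : ℕ → ℂ} (hζ : IsRootSystem ζ)
    {w : ℕ → ℕ → ℂ} (hw : ∀ s ≤ q, ∀ j < 2 ^ s, ‖w s j - ζ s ^ j‖ ≤ μ)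
    (x : Fin (2 ^ q) → ℂ) (k : Fin (2 ^ q)) :
    ‖fftFl fl w q x k - dft ζ q x k‖ ≤ 6 * q * μ * (√(2 ^ q) * l2 x) :=
  (norm_le_l2 (fun k => fftFl fl w q x k - dft ζ q x k) k).trans
    ((l2_fftFl_sub_dft_le hfl hμ hζ q hw x).trans
      (mul_le_mul_of_nonneg_right hsmall (mul_nonneg (Real.sqrt_nonneg _) (l2_nonneg _))))

theorem norm_le_of_entry_le {A : Matrix (Fin m) (Fin m) ℂ} {c : ℝ} (hc : 0 ≤ c)
    (h : ∀ r s, ‖A r s‖ ≤ c) : ‖A‖ ≤ m * c :=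
  norm_le_of_rowSum_le (by positivity) fun r =>
    (Finset.sum_le_sum fun s _ => h r s).trans (by simp)

theorem l2_fin_le {x : Fin (2 ^ q) → ℂ} {c : ℝ} (hc : 0 ≤ c) (h : ∀ i, ‖x i‖ ≤ c) :
    l2 x ≤ √(2 ^ q) * c := by
  have := l2_le_of_forall hc h
  simpa using this

theorem norm_blockFftFl_sub_blockDft_le (hfl : IsRounding μ fl) (hμ : 0 ≤ μ)
    (hsmall : (1 + stageErr μ) ^ q - 1 ≤ 6 * q * μ) {ζ : ℕ → ℂ} (hζ : IsRootSystem ζ)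
    {w : ℕ → ℕ → ℂ} (hw : ∀ s ≤ q, ∀ j < 2 ^ s, ‖w s j - ζ s ^ j‖ ≤ μ)
    {X : Fin (2 ^ q) → Matrix (Fin m) (Fin m) ℂ} {c : ℝ} (hc : 0 ≤ c)
    (hX : ∀ r s, √(2 ^ q) * l2 (fun h => X h r s) ≤ c) (k : Fin (2 ^ q)) :
    ‖blockFftFl fl w X k - blockDft ζ X k‖ ≤ m * (6 * q * μ * c) :=
  norm_le_of_entry_le (by positivity) fun r s =>
    (norm_fftFl_sub_dft_le hfl hμ hsmall hζ hw _ k).trans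
      (mul_le_mul_of_nonneg_left (hX r s) (by positivity))

open scoped Matrix.Norms.Operator in
theorem norm_smul_blockDft_le {ζ : ℕ → ℂ} (hζ : ∀ s, ‖ζ s‖ = 1)
    {Z : Fin (2 ^ q) → Matrix (Fin m) (Fin m) ℂ} {g : ℝ} (hZ : ∀ h, ‖Z h‖ ≤ g)
    (k : Fin (2 ^ q)) : ‖((2 ^ q : ℕ) : ℂ)⁻¹ • blockDft ζ Z k‖ ≤ g := by
  have h1 : blockDft ζ Z k = ∑ h : Fin (2 ^ q), ζ q ^ ((k : ℕ) * h) • Z h := by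
    ext r s
    simp [blockDft, dft, Matrix.sum_apply]
  have h2 : ‖blockDft ζ Z k‖ ≤ (2 ^ q : ℕ) * g := by
    rw [h1]
    refine (norm_sum_le _ _).trans ((Finset.sum_le_sum (g := fun _ => g) fun h _ => ?_).trans
      (by simp))
    rw [norm_smul, norm_pow, hζ, one_pow, one_mul]
    exact hZ h
  rw [norm_smul, norm_inv, Complex.norm_natCast, inv_mul_le_iff₀ (by positivity)]
  exact h2

theorem blockDft_sub (ζ : ℕ → ℂ) (X Z : Fin (2 ^ q) → Matrix (Fin m) (Fin m) ℂ)
    (k : Fin (2 ^ q)) :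
    blockDft ζ (fun h => X h - Z h) k = blockDft ζ X k - blockDft ζ Z k := by
  ext r s
  simp [blockDft, dft, mul_sub]

/-- The first block-row of the exponential of the block-circulant matrix of `U`. -/
noncomputable def circExp (U : Fin (2 ^ q) → Matrix (Fin m) (Fin m) ℝ) :
    Fin (2 ^ q) → Matrix (Fin m) (Fin m) ℂ :=
  fun k => ((2 ^ q : ℕ) : ℂ)⁻¹ • blockDft unitRoot (fun h => NormedSpace.exp
    (blockDft (fun s => starRingEnd ℂ (unitRoot s)) (toComplex U) h)) k

open scoped Matrix.Norms.Operator in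
/-- Error of the computed exponentials, from the error `d` of their arguments. -/
theorem norm_expFl_sub_exp_le [NeZero m] {V V' W : Matrix (Fin m) (Fin m) ℂ} {c d : ℝ}
    (hμτ : 0 ≤ μ * τ) (hV : ‖V + (c : ℂ) • (1 : Matrix (Fin m) (Fin m) ℂ)‖ ≤ c)
    (hd : ‖V' - V‖ ≤ d) (hW : IsExpFl fl μ τ V' W) :
    ‖W - NormedSpace.exp V‖ ≤ Real.exp d - 1 + μ * τ * Real.exp d := by
  have : Nonempty (Fin m) := ⟨0⟩
  have h1 : ‖NormedSpace.exp V' - NormedSpace.exp V‖ ≤ Real.exp d - 1 := by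
    have := norm_exp_add_sub_exp_le_of_shift hV hd
    rwa [add_sub_cancel] at this
  -- The shift bound is known for `V` only, so the computed argument `V'` is reached by
  -- perturbation.
  have h2 : ‖NormedSpace.exp V'‖ ≤ Real.exp d := by
    have h3 := norm_le_norm_add_norm_sub' (NormedSpace.exp V') (NormedSpace.exp V)
    have h4 := norm_exp_le_one hV
    exact h3.trans ((add_le_add h4 h1).trans (by linarith))
  calc ‖W - NormedSpace.exp V‖
      ≤ ‖W - NormedSpace.exp V'‖ + ‖NormedSpace.exp V' - NormedSpace.exp V‖ :=
        norm_sub_le_norm_sub_add_norm_sub _ _ _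
    _ ≤ μ * τ * Real.exp d + (Real.exp d - 1) :=
        add_le_add (hW.error.trans (mul_le_mul_of_nonneg_left h2 hμτ)) h1
    _ = _ := add_comm _ _

open scoped Matrix.Norms.Operator in
/-- Error of the algorithm, for a precision at which the error of the FFT is under control. -/
theorem norm_circExp_sub_le [NeZero m] {U : Fin (2 ^ q) → Matrix (Fin m) (Fin m) ℝ}
    (hU : IsSubgenerator (blockToeplitz U)) (hτ : 0 < τ) (hfl : IsRounding μ fl) (hμ : 0 ≤ μ)
    (hsmall : (1 + stageErr μ) ^ q - 1 ≤ 6 * q * μ) {w : ℕ → ℕ → ℂ} (hw : IsRootTable μ q w)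
    {M N g : ℝ} (hM0 : 0 ≤ M) (hN0 : 0 ≤ N) (hM : ∀ h r s, |U h r s| ≤ M)
    (hN : ∀ h, ‖circExp U h‖ ≤ N)
    (hg : g = Real.exp (m * (6 * q * μ * (2 ^ q * M))) - 1
      + μ * τ * Real.exp (m * (6 * q * μ * (2 ^ q * M))))
    {Yhat : Fin (2 ^ q) → Matrix (Fin m) (Fin m) ℂ}
    (hY : IsCircExpFl fl w μ τ (toComplex U) Yhat) (k : Fin (2 ^ q)) :
    ‖circExp U k - Yhat k‖ ≤ g + m * (6 * q * μ * (√(2 ^ q) * N + g)) := by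
  obtain ⟨V', W, hV', hW, hYW⟩ := hY
  have hroot := isRootSystem_unitRoot
  have hroot' := isRootSystem_conj hroot
  have hw' : ∀ s ≤ q, ∀ j < 2 ^ s,
      ‖starRingEnd ℂ (w s j) - (starRingEnd ℂ (unitRoot s)) ^ j‖ ≤ μ := by
    intro s hs j hj
    rw [← map_pow, ← map_sub, RCLike.norm_conj]
    exact hw s hs j hj
  have hn : √(2 ^ q) * √(2 ^ q) = (2 : ℝ) ^ q := Real.mul_self_sqrt (by positivity)
  set V := blockDft (fun s => starRingEnd ℂ (unitRoot s)) (toComplex U)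
  have hd : ∀ h, ‖V' h - V h‖ ≤ m * (6 * q * μ * (2 ^ q * M)) := by
    intro h
    rw [hV']
    refine norm_blockFftFl_sub_blockDft_le hfl hμ hsmall hroot' hw' (by positivity)
      (fun r s => ?_) h
    rw [show (2 : ℝ) ^ q * M = √(2 ^ q) * (√(2 ^ q) * M) by rw [← mul_assoc, hn]]
    refine mul_le_mul_of_nonneg_left (l2_fin_le hM0 fun i => ?_) (Real.sqrt_nonneg _)
    simpa [toComplex] using hM i r s
  have hWE : ∀ h, ‖W h - NormedSpace.exp (V h)‖ ≤ g := fun h => hg ▸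
    norm_expFl_sub_exp_le (by positivity) (norm_blockDft_add_smul_le hU hroot'.norm_one h)
      (hd h) (hW h)
  have hg0 : 0 ≤ g := (norm_nonneg _).trans (hWE 0)
  -- Parseval read backwards: the transform of the exponentials is `n` times the exact result, so
  -- its entries are at most `nN`.
  have hE : ∀ r s, √(2 ^ q) * l2 (fun h => NormedSpace.exp (V h) r s)
      ≤ √(2 ^ q) * (2 ^ q * N) := by
    intro r s
    rw [← l2_dft_eq hroot]
    refine l2_fin_le (by positivity) fun i => ?_
    have h1 := (entry_le_norm (circExp U i) r s).trans (hN i)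
    change ‖((2 ^ q : ℕ) : ℂ)⁻¹ * dft unitRoot q (fun h => NormedSpace.exp (V h) r s) i‖ ≤ N at h1
    rw [norm_mul, norm_inv, Complex.norm_natCast, inv_mul_le_iff₀ (by positivity)] at h1
    simpa using h1
  have hfft : ‖blockFftFl fl w W k - blockDft unitRoot W k‖
      ≤ m * (6 * q * μ * (2 ^ q * (√(2 ^ q) * N + g))) := by
    refine norm_blockFftFl_sub_blockDft_le hfl hμ hsmall hroot hw (by positivity)
      (fun r s => ?_) k
    have h1 := l2_add_le (fun h => W h r s - NormedSpace.exp (V h) r s)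
      (fun h => NormedSpace.exp (V h) r s)
    simp only [sub_add_cancel] at h1
    have h2 : l2 (fun h => W h r s - NormedSpace.exp (V h) r s) ≤ √(2 ^ q) * g :=
      l2_fin_le hg0 fun i => (entry_le_norm (W i - NormedSpace.exp (V i)) r s).trans (hWE i)
    calc √(2 ^ q) * l2 (fun h => W h r s)
        ≤ √(2 ^ q) * (√(2 ^ q) * g) + √(2 ^ q) * l2 (fun h => NormedSpace.exp (V h) r s) := by
          rw [← mul_add]
          exact mul_le_mul_of_nonneg_left (by linarith) (Real.sqrt_nonneg _)
      _ ≤ √(2 ^ q) * (√(2 ^ q) * g) + √(2 ^ q) * (2 ^ q * N) := by linarith [hE r s]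
      _ = _ := by rw [← mul_assoc, hn]; ring
  have hYk : Yhat k = ((2 ^ q : ℕ) : ℂ)⁻¹ • blockFftFl fl w W k := by
    ext r s
    rw [hYW]
    exact hfl.divFl_two_pow (hfl.isMachine_fftFl w q _ (fun j => (hW j).machine r s) k) q
  have hsplit : circExp U k - Yhat k
      = ((2 ^ q : ℕ) : ℂ)⁻¹ • blockDft unitRoot (fun h => NormedSpace.exp (V h) - W h) k
        - ((2 ^ q : ℕ) : ℂ)⁻¹ • (blockFftFl fl w W k - blockDft unitRoot W k) := by
    rw [hYk, blockDft_sub, ← smul_sub]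
    change _ • _ - _ • _ = _
    rw [← smul_sub]
    congr 1
    abel
  rw [hsplit]
  refine (norm_sub_le _ _).trans (add_le_add ?_ ?_)
  · exact norm_smul_blockDft_le hroot.norm_one (fun h => by rw [norm_sub_rev]; exact hWE h) k
  · rw [norm_smul, norm_inv, Complex.norm_natCast, inv_mul_le_iff₀ (by positivity)]
    refine hfft.trans (le_of_eq ?_)
    push_cast
    ring

end CircExp

/-! ### Choice of `γ` and collection of the first-order terms. -/

theorem mainTheorem7 (q m : ℕ) (U : Fin (2 ^ q) → Matrix (Fin m) (Fin m) ℝ)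
    (hU : CircExp.IsSubgenerator (CircExp.blockToeplitz U)) (τ : ℝ) (hτ : 0 < τ) :
    ∃ Y : Fin (2 ^ q) → Matrix (Fin m) (Fin m) ℂ,
      CircExp.blockCirculant Y
        = NormedSpace.exp (CircExp.blockCirculant (CircExp.toComplex U)) ∧
      ∃ γ : ℝ → ℝ,
        (fun μ => γ μ - (4 * Real.sqrt 2 + 1)) =O[𝓝[>] 0] (fun μ => μ) ∧
        ∀ᶠ μ in 𝓝[>] (0 : ℝ),
          ∀ fl : ℝ → ℝ, CircExp.IsRounding μ fl →
          ∀ w : ℕ → ℕ → ℂ, CircExp.IsRootTable μ q w →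
          ∀ Yhat : Fin (2 ^ q) → Matrix (Fin m) (Fin m) ℂ,
            CircExp.IsCircExpFl fl w μ τ (CircExp.toComplex U) Yhat →
            ∀ k, ‖Y k - Yhat k‖ ≤ μ * m * CircExp.chi (γ μ) τ U Y := by
  refine ⟨CircExp.circExp U, CircExp.blockCirculant_exp (CircExp.toComplex U),
    fun _ => 4 * √2 + 1, by simpa using isBigO_zero _ _, ?_⟩
  rcases Nat.eq_zero_or_pos m with rfl | hm
  · refine Eventually.of_forall fun μ fl _ w _ Yhat _ k => ?_
    rw [Subsingleton.elim (CircExp.circExp U k - Yhat k) 0]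
    simp
  have : NeZero m := ⟨hm.ne'⟩
  have hm1 : (1 : ℝ) ≤ m := by exact_mod_cast hm
  set M := ⨆ h, ⨆ r, ⨆ s, |U h r s| with hMdef
  set N := ⨆ h, ‖CircExp.circExp U h‖ with hNdef
  have hM : ∀ h r s, |U h r s| ≤ M := fun h r s =>
    (le_ciSup (f := fun s => |U h r s|) (Set.finite_range _).bddAbove s).trans <|
      (le_ciSup (f := fun r => ⨆ s, |U h r s|) (Set.finite_range _).bddAbove r).trans <|
        le_ciSup (f := fun h => ⨆ r, ⨆ s, |U h r s|) (Set.finite_range _).bddAbove h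
  have hN : ∀ h, ‖CircExp.circExp U h‖ ≤ N := fun h =>
    le_ciSup (f := fun h => ‖CircExp.circExp U h‖) (Set.finite_range _).bddAbove h
  have hN0 : 0 ≤ N := (norm_nonneg _).trans (hN 0)
  -- Strict positivity comes from the negative diagonal and is needed for a strict gap between
  -- first-order coefficients.
  have hM0 : 0 < M := by
    have h := hU.diag_neg (0, 0)
    simp only [CircExp.blockToeplitz, le_refl, if_true, sub_self] at h
    exact (abs_pos.2 h.ne).trans_le (hM 0 0 0)
  have hchi : ∀ γ, CircExp.chi γ τ U (CircExp.circExp U)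
      = m * 2 ^ q * γ * q * M + γ * √(2 ^ q) * q * N + τ := by
    intro γ
    rw [CircExp.chi, ← hMdef, ← hNdef]
    simp [Real.logb_pow]
  have h6 : 6 < 4 * √2 + 1 := by
    have : (1.4 : ℝ) < √2 := by rw [Real.lt_sqrt (by norm_num)]; norm_num
    linarith
  set G := 4 * √2 + 1
  have htotal : ∀ᶠ μ in 𝓝[>] (0 : ℝ),
      (Real.exp (m * 6 * q * 2 ^ q * M * μ) - 1
          + μ * τ * Real.exp (m * 6 * q * 2 ^ q * M * μ))
        + (m * 6 * q) * μ * (Real.exp (m * 6 * q * 2 ^ q * M * μ) - 1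
          + μ * τ * Real.exp (m * 6 * q * 2 ^ q * M * μ))
      ≤ m * (m * 2 ^ q * G * q * M + τ) * μ := by
    -- For `q = 0` there is no gap when `m = 1`, but the left side is then exactly `μτ`.
    rcases Nat.eq_zero_or_pos q with rfl | hq
    · filter_upwards [self_mem_nhdsWithin] with μ hμ
      have hμ' : 0 < μ := hμ
      have : τ * μ ≤ m * (τ * μ) := le_mul_of_one_le_left (by positivity) hm1
      simp
      linarith
    · refine CircExp.eventually_total_le ?_
      have hq' : (0 : ℝ) < q := by exact_mod_cast hq
      have hp : 0 < m * 2 ^ q * q * M := by positivity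
      have h1 : m * 6 * q * 2 ^ q * M + τ < m * 2 ^ q * G * q * M + τ := by nlinarith
      have h2 : 0 ≤ m * 2 ^ q * G * q * M + τ := by positivity
      nlinarith
  filter_upwards [htotal, CircExp.eventually_fftErr_le q, self_mem_nhdsWithin] with
    μ htot hsmall hμ fl hfl w hw Yhat hY k
  have hμ0 : 0 < μ := hμ
  have h := CircExp.norm_circExp_sub_le hU hτ hfl hμ0.le hsmall hw hM0.le hN0 hM hN rfl hY k
  have harg : m * (6 * q * μ * (2 ^ q * M)) = m * 6 * q * 2 ^ q * M * μ := by ring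
  rw [harg] at h
  refine h.trans ?_
  rw [hchi]
  -- The term in `N` is already linear in `μ`, so `6 ≤ G` handles it directly; `htot` covers the
  -- rest.
  have hY0 : 0 ≤ m * q * μ * (√(2 ^ q) * N) := by positivity
  nlinarith [mul_le_mul_of_nonneg_right h6.le hY0]
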